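/- Let $\mathfrak H$ be a complex Hilbert space and let $S$ be a densely defined closed symmetric operator in $\mathfrak H$. For $\lambda\in\mathbb C\setminus\mathbb R$ put $\mathfrak M_\lambda=\operatorname{ran}(S-\lambda I)$ and $\mathfrak N_\lambda=\mathfrak M_{\bar\lambda}^{\perp}$, and let $P_{\mathfrak M_\lambda}$, $P_{\mathfrak N_\lambda}$ be the orthogonal projections onto these closed subspaces. Assume that $n_+=\dim\mathfrak N_\lambda$ ($\operatorname{Im}\lambda>0$; the dimension does not depend on $\lambda$) is not $0$. For $\mu,z\in\mathbb C_+=\{\lambda:\operatorname{Im}\lambda>0\}$ define a linear operator $S_{\mu,z}$ by $$\operatorname{dom}S_{\mu,z}=\Bigl(P_{\mathfrak M_{\bar z}}+\sqrt{\tfrac{\operatorname{Im}z}{\operatorname{Im}\mu}}\,P_{\mathfrak N_z}\Bigr)\operatorname{dom}S,$$ $$S_{\mu,z}\Bigl(P_{\mathfrak M_{\bar z}}+\sqrt{\tfrac{\operatorname{Im}z}{\operatorname{Im}\mu}}\,P_{\mathfrak N_z}\Bigr)f=\Bigl(P_{\mathfrak M_{\bar z}}+\tfrac{\bar\mu}{\bar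 z}\sqrt{\tfrac{\operatorname{Im}z}{\operatorname{Im}\mu}}\,P_{\mathfrak N_z}\Bigr)Sf,\qquad f\in\operatorname{dom}S.$$ Then for all $\mu,z\in\mathbb C_+$ the operator $S_{\mu,z}$ is symmetric, densely defined and closed. Moreover, writing $\operatorname{dom}A^2=\{f\in\operatorname{dom}A: Af\in\operatorname{dom}A\}$, in each of the following items the three conditions "(a) holds for at least one pair $\mu,z\in\mathbb C_+$", "(a) holds for all pairs $\mu,z\in\mathbb C_+$" and "(b) holds" are equivalent: 1. (a) $\operatorname{dom}S_{\mu,z}^2$ is a core of $S_{\mu,z}$; (b) $\operatorname{dom}S^2$ is a core of $S$. 2. (a) $\operatorname{dom}S_{\mu,z}^2$ is dense in $\mathfrak H$ but not a core of $S_{\mu,z}$; (b) $\operatorname{dom}S^2$ is dense in $\mathfrak H$ but not a core of $S$. 3. (a) $\operatorname{dom}S_{\mu,z}^2$ is not dense in $\mathfrak H$; (b) $\operatorname{dom}S^2$ is not dense in $\mathfrak H$. 4. (a) $\operatorname{dom}S_{\mu,z}^2=\{0\}$; (b) $\operatorname{dom}S^2=\{0\}$. -/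

import Mathlib

open scoped ComplexConjugate

noncomputable section

namespace SymmetricClone

universe u

variable {H : Type u} [NormedAddCommGroup H] [InnerProductSpace ℂ H]

/-- A linear operator `S` in `H`, defined on a linear manifold `dom S`, is symmetric if
`Im (S f, f) = 0` for every `f ∈ dom S`. -/
def IsSymmetric (S : H →ₗ.[ℂ] H) : Prop :=
  ∀ f : S.domain, (inner ℂ (S f) (f : H)).im = 0

/-- The square `S²`, with `dom S² = {f ∈ dom S : S f ∈ dom S}` and `S² f = S (S f)`. -/
def square (S : H →ₗ.[ℂ] H) : H →ₗ.[ℂ] H :=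
  S.comp (S.domRestrict ((S.domain.comap S.toFun).map S.domain.subtype)) (by
    rintro ⟨x, hx, hx'⟩
    obtain ⟨y, hy, rfl⟩ := hx
    exact hy)

theorem mem_square_domain {S : H →ₗ.[ℂ] H} {x : H} :
    x ∈ (square S).domain ↔ ∃ h : x ∈ S.domain, S ⟨x, h⟩ ∈ S.domain := by
  constructor
  · rintro ⟨hx, hx'⟩
    obtain ⟨y, hy, rfl⟩ := hx
    exact ⟨y.2, hy⟩
  · rintro ⟨h, h'⟩
    exact ⟨⟨⟨x, h⟩, h', rfl⟩, h⟩

/-- `𝔐_z = ran (S - z I)`. -/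
def rangeSub (S : H →ₗ.[ℂ] H) (z : ℂ) : Submodule ℂ H :=
  LinearMap.range (S.toFun - z • S.domain.subtype)

/-- `𝔑_z = (ran (S - conj z I))ᗮ`, the deficiency subspace of `S` at `z`. -/
def deficiencySubspace (S : H →ₗ.[ℂ] H) (z : ℂ) : Submodule ℂ H :=
  (rangeSub S (conj z))ᗮ

/-- The Hilbert space dimension: the largest cardinality of an orthonormal set. -/
def hilbertDim (E : Type u) [NormedAddCommGroup E] [InnerProductSpace ℂ E] : Cardinal.{u} :=
  ⨆ w : {w : Set E // Orthonormal ℂ ((↑) : w → E)}, Cardinal.mk w.1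

/-- The deficiency index `n₊ = dim 𝔑_z` of a closed symmetric operator, where `z` is any point of
the open upper half-plane (the dimension does not depend on it); the point `z = i` is used. -/
def posDeficiencyIndex (S : H →ₗ.[ℂ] H) : Cardinal.{u} :=
  hilbertDim (deficiencySubspace S Complex.I)

variable [CompleteSpace H]

/-- The orthogonal projection onto the (closed) subspace `𝔑_z`. -/
def projN (S : H →ₗ.[ℂ] H) (z : ℂ) : H →L[ℂ] H :=
  (rangeSub S (conj z))ᗮ.starProjection

/-- The orthogonal projection onto the closure of `𝔐_z`. For a closed symmetric operator and
non-real `z`, the linear manifold `𝔐_z` is itself closed (`isClosed_rangeSub` below), so that this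
is the orthogonal projection onto `𝔐_z`. -/
def projM (S : H →ₗ.[ℂ] H) (z : ℂ) : H →L[ℂ] H :=
  (rangeSub S z).topologicalClosure.starProjection

/-- The scalar `√(Im z / Im μ)`. -/
def ratio (μ z : ℂ) : ℂ := ((Real.sqrt (z.im / μ.im) : ℝ) : ℂ)

/-- The operator `P_{𝔐_{conj z}} + √(Im z / Im μ) P_{𝔑_z}`. -/
def domMap (S : H →ₗ.[ℂ] H) (μ z : ℂ) : H →L[ℂ] H :=
  projM S (conj z) + ratio μ z • projN S z

/-- The operator `P_{𝔐_{conj z}} + (conj μ / conj z) √(Im z / Im μ) P_{𝔑_z}`. -/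
def valMap (S : H →ₗ.[ℂ] H) (μ z : ℂ) : H →L[ℂ] H :=
  projM S (conj z) + ((conj μ / conj z) * ratio μ z) • projN S z

/-- The clone `S_{μ,z}` of `S`: the operator whose graph consists of the pairs
`(domMap f, valMap (S f))`, `f ∈ dom S`. For `μ, z` in the open upper half-plane this is the graph
of an operator, see `clone_domain`, `clone_apply`. -/
def clone (S : H →ₗ.[ℂ] H) (μ z : ℂ) : H →ₗ.[ℂ] H :=
  (S.graph.map (LinearMap.prodMap (domMap S μ z : H →ₗ[ℂ] H)
    (valMap S μ z : H →ₗ[ℂ] H))).toLinearPMap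

theorem isClosed_rangeSub {S : H →ₗ.[ℂ] H} (hc : S.IsClosed) (hs : IsSymmetric S) {z : ℂ}
    (hz : z.im ≠ 0) : IsClosed (rangeSub S z : Set H) := by
  have key : ∀ f : S.domain, |z.im| * ‖(f : H)‖ ≤ ‖S f - z • (f : H)‖ := by
    intro f
    have h1 : |z.im| * ‖(f : H)‖ ^ 2 ≤ ‖S f - z • (f : H)‖ * ‖(f : H)‖ := by
      have h2 : (inner ℂ (S f - z • (f : H)) (f : H)).im = z.im * ‖(f : H)‖ ^ 2 := by
        rw [inner_sub_left, inner_smul_left, inner_self_eq_norm_sq_to_K, Complex.sub_im, hs f]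
        simp [← Complex.ofReal_pow]
      calc |z.im| * ‖(f : H)‖ ^ 2 = |(inner ℂ (S f - z • (f : H)) (f : H)).im| := by
            rw [h2, abs_mul, abs_of_nonneg (sq_nonneg ‖(f : H)‖)]
        _ ≤ ‖inner ℂ (S f - z • (f : H)) (f : H)‖ := Complex.abs_im_le_norm _
        _ ≤ _ := norm_inner_le_norm _ _
    rcases (norm_nonneg (f : H)).eq_or_lt with h | h
    · rw [← h]; simp
    · nlinarith
  refine isClosed_of_closure_subset fun y hy => ?_
  obtain ⟨u, hu, hlim⟩ := mem_closure_iff_seq_limit.1 hy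
  choose f hf using hu
  have hf' : ∀ n, S (f n) - z • (f n : H) = u n := hf
  have hz' : 0 < |z.im| := abs_pos.2 hz
  have hcau : CauchySeq fun n => (f n : H) := by
    have hu := hlim.cauchySeq
    rw [Metric.cauchySeq_iff'] at hu ⊢
    intro ε hε
    obtain ⟨N, hN⟩ := hu (|z.im| * ε) (by positivity)
    refine ⟨N, fun n hn => ?_⟩
    have h1 := key (f n - f N)
    have h2 : S (f n - f N) - z • ((f n - f N : S.domain) : H) = u n - u N := by
      rw [← hf' n, ← hf' N, LinearPMap.map_sub, Submodule.coe_sub, smul_sub]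
      abel
    have h3 := hN n hn
    rw [h2, Submodule.coe_sub] at h1
    rw [dist_eq_norm] at h3 ⊢
    exact lt_of_mul_lt_mul_left (h1.trans_lt h3) hz'.le
  obtain ⟨x, hx⟩ := cauchySeq_tendsto_of_complete hcau
  have hS : Filter.Tendsto (fun n => ((f n : H), S (f n))) Filter.atTop
      (nhds (x, y + z • x)) := by
    refine hx.prodMk_nhds ?_
    have : (fun n => S (f n)) = fun n => u n + z • (f n : H) := by
      funext n
      rw [← hf' n, sub_add_cancel]
    rw [this]
    exact hlim.add (hx.const_smul z)
  have hmem : (x, y + z • x) ∈ S.graph :=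
    IsClosed.mem_of_tendsto hc hS (Filter.Eventually.of_forall fun n => S.mem_graph (f n))
  obtain ⟨g, hg1, hg2⟩ := (LinearPMap.mem_graph_iff S).1 hmem
  refine ⟨g, ?_⟩
  change S g - z • (g : H) = y
  rw [hg2, hg1]
  simp

theorem projM_add_projN (S : H →ₗ.[ℂ] H) (z : ℂ) (x : H) :
    projM S (conj z) x + projN S z x = x := by
  have h : projN S z x = (rangeSub S (conj z)).topologicalClosureᗮ.starProjection x := by
    unfold projN
    congr 2
    exact (Submodule.orthogonal_closure _).symm
  rw [h]
  exact Submodule.starProjection_add_starProjection_orthogonal x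

theorem domMap_injective (S : H →ₗ.[ℂ] H) {μ z : ℂ} (hμ : 0 < μ.im) (hz : 0 < z.im) :
    Function.Injective (domMap S μ z) := by
  refine (injective_iff_map_eq_zero (domMap S μ z)).2 fun x hx => ?_
  have hk : ratio μ z ≠ 0 := by
    have : 0 < z.im / μ.im := div_pos hz hμ
    simpa [ratio] using (Real.sqrt_pos.2 this).ne'
  have hx' : projM S (conj z) x + ratio μ z • projN S z x = 0 := hx
  have hM : projM S (conj z) x ∈ (rangeSub S (conj z)).topologicalClosure :=
    Submodule.starProjection_apply_mem _ x
  have hN : projN S z x ∈ (rangeSub S (conj z)).topologicalClosureᗮ := by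
    rw [Submodule.orthogonal_closure]
    exact Submodule.starProjection_apply_mem _ x
  have h1 : inner ℂ (projM S (conj z) x) (projN S z x) = 0 := hN _ hM
  have h2 : projM S (conj z) x = 0 := by
    have := congrArg (inner ℂ (projM S (conj z) x)) hx'
    rw [inner_add_right, inner_smul_right, h1, mul_zero, add_zero, inner_zero_right] at this
    exact inner_self_eq_zero.1 this
  have h3 : projN S z x = 0 := by
    rw [h2, zero_add] at hx'
    exact (smul_eq_zero.1 hx').resolve_left hk
  rw [← projM_add_projN S z x, h2, h3, add_zero]

theorem clone_domain (S : H →ₗ.[ℂ] H) (μ z : ℂ) :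
    (clone S μ z).domain = S.domain.map (domMap S μ z : H →ₗ[ℂ] H) := by
  ext x
  rw [clone, Submodule.toLinearPMap_domain]
  constructor
  · rintro ⟨_, ⟨⟨a, b⟩, hab, rfl⟩, rfl⟩
    exact ⟨a, S.mem_domain_of_mem_graph hab, rfl⟩
  · rintro ⟨a, ha, rfl⟩
    exact ⟨_, ⟨(a, S ⟨a, ha⟩), S.mem_graph ⟨a, ha⟩, rfl⟩, rfl⟩

theorem clone_apply (S : H →ₗ.[ℂ] H) {μ z : ℂ} (hμ : 0 < μ.im) (hz : 0 < z.im)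
    (f : S.domain) (h : domMap S μ z f ∈ (clone S μ z).domain) :
    clone S μ z ⟨domMap S μ z f, h⟩ = valMap S μ z (S f) := by
  set g := S.graph.map (LinearMap.prodMap (domMap S μ z : H →ₗ[ℂ] H)
    (valMap S μ z : H →ₗ[ℂ] H)) with hgdef
  have hg : ∀ x ∈ g, x.fst = 0 → x.snd = 0 := by
    rintro _ ⟨⟨a, b⟩, hab, rfl⟩ h0
    have ha : a = 0 := domMap_injective S hμ hz (by simpa using h0)
    have hb : b = 0 := S.graph_fst_eq_zero_snd hab ha
    simp [hb]
  have h1 := LinearPMap.mem_graph (clone S μ z) ⟨domMap S μ z f, h⟩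
  have h2 : (domMap S μ z f, valMap S μ z (S f)) ∈ (clone S μ z).graph := by
    rw [clone, Submodule.toLinearPMap_graph_eq _ hg]
    exact ⟨((f : H), S f), S.mem_graph f, rfl⟩
  exact LinearPMap.mem_graph_snd_inj (clone S μ z) h1 h2 rfl

end SymmetricClone

end

/-!
Let `P` be the projection onto `ran (S - conj z)` and let `R` be the bounded operator
`(S - conj z)⁻¹ P`. The clone `S_{μ,z}` is governed by one identity between resolvents: with
`c = conj z - conj μ` and `D = domMap S μ z`, the operator `1 + c R` is boundedly invertible, and
with `G = D (1 + c R)⁻¹`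
* `ran (S_{μ,z} - conj μ) = ran (S - conj z)`, and `(S_{μ,z} - conj μ)⁻¹ = G (S - conj z)⁻¹` there;
* `dom S_{μ,z}` and `dom S` have the same intersection with this common range, because
  `dom S_{μ,z} = D (dom S)` and `D` is diagonal, and the identity on `ran (S - conj z)`.

This relation is called `ResolventSimilar` below, and `exists_resolventSimilar_clone` establishes
it. The invertibility of `1 + c R` (`isUnit_one_add_smul_resolvent`) is a Neumann series argument:
up to an invertible diagonal factor, `1 + c R` is `1 - t K`, where `K` is the Cayley transform of
`S` extended by zero, a contraction, and `|t| = |conj z - conj μ| / |z - conj μ| < 1` since `μ` and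
`z` are both in the upper half-plane.

Since `S - α` maps `dom S²` bijectively onto `ran (S - α) ∩ dom S`, the relation gives
`dom S_{μ,z} = G (dom S)` and `dom S_{μ,z}² = G (dom S²)`, and the homeomorphism
`(x, y) ↦ (G x, y - conj z x + conj μ G x)` takes the graph of `S` onto that of `S_{μ,z}`. Hence
density of the domain, closedness, and each of the properties of `dom S²` in the theorem pass
between `S` and every clone. The symmetry of the clone is the direct computation
`isSymmetric_clone`, which rests on `P_𝔑 S = conj z P_𝔑` on `dom S`.
-/

namespace SymmetricClone

universe u

/-! ### Cores and squares in terms of graphs -/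

variable {H : Type u} [NormedAddCommGroup H] [InnerProductSpace ℂ H]

theorem mem_graph_domRestrict {A : H →ₗ.[ℂ] H} {D : Submodule ℂ H} {p : H × H} :
    p ∈ (A.domRestrict D).graph ↔ p ∈ A.graph ∧ p.1 ∈ D := by
  constructor
  · intro hp
    exact ⟨LinearPMap.le_graph_of_le LinearPMap.domRestrict_le hp,
      (LinearPMap.mem_domain_of_mem_graph (f := A.domRestrict D) (x := p.1) (y := p.2) hp).1⟩
  · rintro ⟨hp, hD⟩
    obtain ⟨x, hx, hy⟩ := (LinearPMap.mem_graph_iff A).1 hp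
    refine (LinearPMap.mem_graph_iff _).2 ⟨⟨p.1, hD, hx ▸ x.2⟩, rfl, ?_⟩
    rw [← hy]
    exact LinearPMap.domRestrict_apply hx.symm

/-- A submodule of the domain of a closed operator is a core exactly if the part of the graph
above it is dense in the graph. -/
theorem hasCore_iff {A : H →ₗ.[ℂ] H} (hA : A.IsClosed) {D : Submodule ℂ H} (hD : D ≤ A.domain) :
    A.HasCore D ↔ ∀ p ∈ A.graph, p ∈ closure {q : H × H | q ∈ A.graph ∧ q.1 ∈ D} := by
  have hcl : (A.domRestrict D).IsClosable :=
    hA.isClosable.leIsClosable LinearPMap.domRestrict_le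
  have hset : ((A.domRestrict D).graph : Set (H × H)) = {q | q ∈ A.graph ∧ q.1 ∈ D} := by
    ext q
    exact mem_graph_domRestrict
  have hgr : ((A.domRestrict D).closure.graph : Set (H × H)) =
      closure {q : H × H | q ∈ A.graph ∧ q.1 ∈ D} := by
    rw [← hset, ← hcl.graph_closure_eq_closure_graph, Submodule.topologicalClosure_coe]
  constructor
  · intro h p hp
    rw [← hgr, h.closure_eq]
    exact hp
  · intro h
    refine ⟨hD, LinearPMap.eq_of_eq_graph (SetLike.coe_injective ?_)⟩
    rw [hgr]
    exact Set.Subset.antisymm (closure_minimal (fun q hq => hq.1) hA) h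

theorem mem_square_domain_iff_graph {A : H →ₗ.[ℂ] H} {x : H} :
    x ∈ (square A).domain ↔ ∃ y, (x, y) ∈ A.graph ∧ y ∈ A.domain := by
  rw [mem_square_domain]
  constructor
  · rintro ⟨h, h'⟩
    exact ⟨_, A.mem_graph ⟨x, h⟩, h'⟩
  · rintro ⟨y, hxy, hy⟩
    obtain ⟨x', hx', rfl⟩ := (LinearPMap.mem_graph_iff A).1 hxy
    obtain rfl : (x' : H) = x := hx'
    exact ⟨x'.2, hy⟩

theorem square_domain_le (A : H →ₗ.[ℂ] H) : (square A).domain ≤ A.domain := fun _ hx =>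
  (mem_square_domain.1 hx).1

/-- If `(x, m + α x)` is in the graph of `A`, then `x ∈ dom A²` exactly if `m = (A - α) x`
belongs to `dom A`. -/
theorem mem_square_domain_iff_of_graph {A : H →ₗ.[ℂ] H} {α : ℂ} {x m : H}
    (h : (x, m + α • x) ∈ A.graph) : x ∈ (square A).domain ↔ m ∈ A.domain := by
  have hx : x ∈ A.domain := LinearPMap.mem_domain_of_mem_graph h
  rw [mem_square_domain_iff_graph]
  constructor
  · rintro ⟨y, hy, hyA⟩
    obtain rfl : y = m + α • x := LinearPMap.mem_graph_snd_inj A hy h rfl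
    simpa using A.domain.sub_mem hyA (A.domain.smul_mem α hx)
  · intro hm
    exact ⟨_, h, A.domain.add_mem hm (A.domain.smul_mem α hx)⟩

/-! ### Operators with similar resolvents -/

/-- The relation `(B - β)⁻¹ = G (A - α)⁻¹`, where the two inverses have the same domain
`ran (A - α) = ran (B - β)`, together with the requirement that `dom A` and `dom B` have the same
intersection with this common range. The inverses are encoded by graphs: `(A - α) x = m` is
written `(x, m + α x) ∈ graph A`. -/
structure ResolventSimilar (A B : H →ₗ.[ℂ] H) (α β : ℂ) (G : H ≃L[ℂ] H) : Prop where
  mem_graph_iff : ∀ x m, (x, m + α • x) ∈ A.graph ↔ (G x, m + β • G x) ∈ B.graph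
  mem_domain_iff : ∀ x m, (x, m + α • x) ∈ A.graph → (m ∈ A.domain ↔ m ∈ B.domain)

namespace ResolventSimilar

variable {A B : H →ₗ.[ℂ] H} {α β : ℂ} {G : H ≃L[ℂ] H}

theorem symm (h : ResolventSimilar A B α β G) : ResolventSimilar B A β α G.symm where
  mem_graph_iff x m := by
    have := h.mem_graph_iff (G.symm x) m
    rw [G.apply_symm_apply] at this
    exact this.symm
  mem_domain_iff x m hx := by
    have := h.mem_graph_iff (G.symm x) m
    rw [G.apply_symm_apply] at this
    exact (h.mem_domain_iff _ m (this.2 hx)).symm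

theorem map_mem_graph (h : ResolventSimilar A B α β G) {x y : H} (hxy : (x, y) ∈ A.graph) :
    (G x, y - α • x + β • G x) ∈ B.graph :=
  (h.mem_graph_iff x _).1 (by rwa [sub_add_cancel])

theorem map_mem_domain (h : ResolventSimilar A B α β G) {x : H} (hx : x ∈ A.domain) :
    G x ∈ B.domain :=
  LinearPMap.mem_domain_of_mem_graph (h.map_mem_graph (A.mem_graph ⟨x, hx⟩))

theorem map_mem_square_domain (h : ResolventSimilar A B α β G) {x : H}
    (hx : x ∈ (square A).domain) : G x ∈ (square B).domain := by
  have hg := A.mem_graph ⟨x, square_domain_le A hx⟩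
  set y := A ⟨x, square_domain_le A hx⟩
  have hg' : (x, (y - α • x) + α • x) ∈ A.graph := by rwa [sub_add_cancel]
  rw [mem_square_domain_iff_of_graph ((h.mem_graph_iff _ _).1 hg'),
    ← h.mem_domain_iff _ _ hg', ← mem_square_domain_iff_of_graph hg']
  exact hx

theorem dense_domain (h : ResolventSimilar A B α β G) (hA : Dense (A.domain : Set H)) :
    Dense (B.domain : Set H) := by
  refine (G.surjective.denseRange.dense_image G.continuous hA).mono ?_
  rintro _ ⟨x, hx, rfl⟩
  exact h.map_mem_domain hx

theorem dense_square_domain (h : ResolventSimilar A B α β G)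
    (hA : Dense ((square A).domain : Set H)) : Dense ((square B).domain : Set H) := by
  refine (G.surjective.denseRange.dense_image G.continuous hA).mono ?_
  rintro _ ⟨x, hx, rfl⟩
  exact h.map_mem_square_domain hx

theorem dense_square_domain_iff (h : ResolventSimilar A B α β G) :
    Dense ((square B).domain : Set H) ↔ Dense ((square A).domain : Set H) :=
  ⟨h.symm.dense_square_domain, h.dense_square_domain⟩

theorem square_domain_eq_bot (h : ResolventSimilar A B α β G) (hB : (square B).domain = ⊥) :
    (square A).domain = ⊥ := by
  rw [Submodule.eq_bot_iff] at hB ⊢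
  intro x hx
  simpa using hB _ (h.map_mem_square_domain hx)

theorem square_domain_eq_bot_iff (h : ResolventSimilar A B α β G) :
    (square B).domain = ⊥ ↔ (square A).domain = ⊥ :=
  ⟨h.square_domain_eq_bot, h.symm.square_domain_eq_bot⟩

theorem isClosed (h : ResolventSimilar A B α β G) (hA : A.IsClosed) : B.IsClosed := by
  have hpre : (B.graph : Set (H × H)) =
      (fun p : H × H => (G.symm p.1, p.2 - β • p.1 + α • G.symm p.1)) ⁻¹' A.graph := by
    ext ⟨x, y⟩
    refine ⟨fun hxy => h.symm.map_mem_graph hxy, fun hxy => ?_⟩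
    simpa using h.map_mem_graph hxy
  rw [LinearPMap.IsClosed, hpre]
  exact IsClosed.preimage (by fun_prop) hA

theorem hasCore (h : ResolventSimilar A B α β G) (hA : A.IsClosed)
    (hcore : A.HasCore (square A).domain) : B.HasCore (square B).domain := by
  rw [hasCore_iff hA (square_domain_le A)] at hcore
  rw [hasCore_iff (h.isClosed hA) (square_domain_le B)]
  rintro ⟨x, y⟩ hxy
  have hmem := hcore _ (h.symm.map_mem_graph hxy)
  have hcont : Continuous fun p : H × H => (G p.1, p.2 - α • p.1 + β • G p.1) := by fun_prop
  have := map_mem_closure hcont hmem (t := {q : H × H | q ∈ B.graph ∧ q.1 ∈ (square B).domain})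
    (fun q hq => ⟨h.map_mem_graph hq.1, h.map_mem_square_domain hq.2⟩)
  simpa using this

theorem hasCore_iff (h : ResolventSimilar A B α β G) (hA : A.IsClosed) :
    B.HasCore (square B).domain ↔ A.HasCore (square A).domain :=
  ⟨h.symm.hasCore (h.isClosed hA), h.hasCore hA⟩

end ResolventSimilar

/-! ### The resolvent of a closed symmetric operator on the range of `S - conj z` -/

theorem inner_im_eq_zero_of_mem_graph {S : H →ₗ.[ℂ] H} (hs : IsSymmetric S) {x y : H}
    (h : (x, y) ∈ S.graph) : (inner ℂ y x).im = 0 := by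
  obtain ⟨f, hf, rfl⟩ := (LinearPMap.mem_graph_iff S).1 h
  obtain rfl : (f : H) = x := hf
  exact hs f

/-- The Cayley transform `(S - conj z) x ↦ (S - z) x` is isometric. -/
theorem norm_sub_smul_eq_norm_sub_conj_smul {S : H →ₗ.[ℂ] H} (hs : IsSymmetric S) (z : ℂ) {x y : H}
    (h : (x, y) ∈ S.graph) : ‖y - z • x‖ = ‖y - conj z • x‖ := by
  have him := inner_im_eq_zero_of_mem_graph hs h
  have h2 : ‖y - z • x‖ ^ 2 = ‖y - conj z • x‖ ^ 2 := by
    rw [norm_sub_sq (𝕜 := ℂ), norm_sub_sq (𝕜 := ℂ), inner_smul_right, inner_smul_right]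
    simp [norm_smul, him]
  exact (sq_eq_sq₀ (norm_nonneg _) (norm_nonneg _)).1 h2

/-- The lower bound for `S - conj z`, obtained from the isometry of the Cayley transform because
`(z - conj z) x` is the difference of `(S - conj z) x` and `(S - z) x`. -/
theorem im_mul_norm_le {S : H →ₗ.[ℂ] H} (hs : IsSymmetric S) {z : ℂ} (hz : 0 < z.im) {x y : H}
    (h : (x, y) ∈ S.graph) : z.im * ‖x‖ ≤ ‖y - conj z • x‖ := by
  have h1 : (z - conj z) • x = (y - conj z • x) - (y - z • x) := by
    rw [sub_smul]; abel
  have h2 : ‖z - conj z‖ = 2 * z.im := by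
    rw [Complex.sub_conj]
    simp [abs_of_pos hz]
  have h3 := norm_sub_le (y - conj z • x) (y - z • x)
  rw [← h1, norm_smul, h2, norm_sub_smul_eq_norm_sub_conj_smul hs z h] at h3
  linarith

theorem sub_smul_mem_rangeSub {S : H →ₗ.[ℂ] H} {z : ℂ} {x y : H}
    (h : (x, y) ∈ S.graph) : y - z • x ∈ rangeSub S z := by
  obtain ⟨f, hf, rfl⟩ := (LinearPMap.mem_graph_iff S).1 h
  obtain rfl : (f : H) = x := hf
  exact ⟨f, rfl⟩

variable [CompleteSpace H]

theorem projM_mul_self (S : H →ₗ.[ℂ] H) (z : ℂ) : projM S z * projM S z = projM S z :=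
  Submodule.isIdempotentElem_starProjection _

theorem projM_sub_smul {S : H →ₗ.[ℂ] H} {z : ℂ} {x y : H} (h : (x, y) ∈ S.graph) :
    projM S z (y - z • x) = y - z • x :=
  Submodule.starProjection_eq_self_iff.2
    (Submodule.le_topologicalClosure _ (sub_smul_mem_rangeSub h))

theorem projN_eq (S : H →ₗ.[ℂ] H) (z : ℂ) : projN S z = 1 - projM S (conj z) := by
  ext x
  exact eq_sub_of_add_eq' (projM_add_projN S z x)

theorem projM_eq_self_iff_mem_rangeSub {S : H →ₗ.[ℂ] H} (hc : S.IsClosed) (hs : IsSymmetric S)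
    {z : ℂ} (hz : z.im ≠ 0) {x : H} : projM S z x = x ↔ x ∈ rangeSub S z := by
  rw [projM, Submodule.starProjection_eq_self_iff,
    (isClosed_rangeSub hc hs hz).submodule_topologicalClosure_eq]

/-- The bounded inverse of `S - conj z` on the closed subspace `ran (S - conj z)`, extended by zero
to the orthogonal complement of this subspace. -/
theorem exists_resolvent {S : H →ₗ.[ℂ] H} (hc : S.IsClosed) (hs : IsSymmetric S) {z : ℂ}
    (hz : 0 < z.im) :
    ∃ R : H →L[ℂ] H, ∀ x, (R x, projM S (conj z) x + conj z • R x) ∈ S.graph := by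
  have hz' : (conj z).im ≠ 0 := by simpa using hz.ne'
  set L : S.domain →ₗ[ℂ] H := S.toFun - conj z • S.domain.subtype with hL
  have hLf : ∀ f : S.domain, L f = S f - conj z • (f : H) := fun f => rfl
  have hbound : ∀ f : S.domain, z.im * ‖(f : H)‖ ≤ ‖L f‖ := fun f =>
    im_mul_norm_le hs hz (S.mem_graph f)
  have hinj : Function.Injective L := by
    refine (injective_iff_map_eq_zero L).2 fun f hf => ?_
    have := hbound f
    rw [hf, norm_zero] at this
    have h0 : ‖(f : H)‖ ≤ 0 := by
      by_contra! hlt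
      exact absurd this (not_le.2 (mul_pos hz hlt))
    exact Subtype.ext (norm_le_zero_iff.1 h0)
  have hP : ∀ x, projM S (conj z) x ∈ LinearMap.range L := fun x =>
    (projM_eq_self_iff_mem_rangeSub hc hs hz').1
      (DFunLike.congr_fun (projM_mul_self S (conj z)) x)
  let e := LinearEquiv.ofInjective L hinj
  let R₀ : H →ₗ[ℂ] S.domain :=
    e.symm.toLinearMap ∘ₗ LinearMap.codRestrict _ (projM S (conj z) : H →ₗ[ℂ] H) hP
  have hR₀ : ∀ x, L (R₀ x) = projM S (conj z) x := fun x =>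
    congrArg Subtype.val (e.apply_symm_apply ⟨projM S (conj z) x, hP x⟩)
  refine ⟨LinearMap.mkContinuous (S.domain.subtype ∘ₗ R₀) z.im⁻¹ fun x => ?_, fun x => ?_⟩
  · have h1 := hbound (R₀ x)
    rw [hR₀] at h1
    have h2 : ‖projM S (conj z) x‖ ≤ ‖x‖ := Submodule.norm_starProjection_apply_le _ x
    rw [inv_mul_eq_div, le_div_iff₀ hz, mul_comm]
    exact h1.trans h2
  · have h1 : projM S (conj z) x + conj z • (R₀ x : H) = S (R₀ x) := by
      rw [← hR₀, hLf, sub_add_cancel]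
    change ((R₀ x : H), projM S (conj z) x + conj z • (R₀ x : H)) ∈ S.graph
    rw [h1]
    exact S.mem_graph _

section Resolvent

variable {S : H →ₗ.[ℂ] H} {μ z : ℂ} {R : H →L[ℂ] H}

theorem resolvent_sub_smul (hs : IsSymmetric S) (hz : 0 < z.im)
    (hR : ∀ x, (R x, projM S (conj z) x + conj z • R x) ∈ S.graph) {x y : H}
    (h : (x, y) ∈ S.graph) : R (y - conj z • x) = x := by
  have h1 := hR (y - conj z • x)
  rw [projM_sub_smul h] at h1
  have h2 := im_mul_norm_le hs hz (S.graph.sub_mem h1 h)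
  have h3 : y - conj z • x + conj z • R (y - conj z • x) - y
      - conj z • (R (y - conj z • x) - x) = 0 := by
    rw [smul_sub]; abel
  rw [h3, norm_zero] at h2
  have h0 : ‖R (y - conj z • x) - x‖ ≤ 0 := by
    by_contra! hlt
    exact absurd h2 (not_le.2 (mul_pos hz hlt))
  exact sub_eq_zero.1 (norm_le_zero_iff.1 h0)

theorem mem_graph_iff_resolvent (hs : IsSymmetric S) (hz : 0 < z.im)
    (hR : ∀ x, (R x, projM S (conj z) x + conj z • R x) ∈ S.graph) {x m : H} :
    (x, m + conj z • x) ∈ S.graph ↔ projM S (conj z) m = m ∧ R m = x := by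
  constructor
  · intro h
    have h1 := projM_sub_smul (z := conj z) h
    have h2 := resolvent_sub_smul hs hz hR h
    rw [add_sub_cancel_right] at h1 h2
    exact ⟨h1, h2⟩
  · rintro ⟨hm, rfl⟩
    have := hR m
    rwa [hm] at this

theorem resolvent_mul_projM (hs : IsSymmetric S) (hz : 0 < z.im)
    (hR : ∀ x, (R x, projM S (conj z) x + conj z • R x) ∈ S.graph) :
    R * projM S (conj z) = R := by
  ext x
  exact ((mem_graph_iff_resolvent hs hz hR).1 (hR x)).2

/-- The extension by zero of the Cayley transform, `projM - (z - conj z) R`, is a contraction. -/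
theorem norm_cayley_le (hs : IsSymmetric S)
    (hR : ∀ x, (R x, projM S (conj z) x + conj z • R x) ∈ S.graph) :
    ‖projM S (conj z) - (z - conj z) • R‖ ≤ 1 := by
  refine ContinuousLinearMap.opNorm_le_bound _ zero_le_one fun x => ?_
  have h1 := norm_sub_smul_eq_norm_sub_conj_smul hs z (hR x)
  rw [add_sub_cancel_right] at h1
  have h2 : (projM S (conj z) - (z - conj z) • R) x =
      projM S (conj z) x + conj z • R x - z • R x := by
    change projM S (conj z) x - (z - conj z) • R x = _
    rw [sub_smul]; abel
  rw [h2, h1, one_mul]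
  exact Submodule.norm_starProjection_apply_le _ x

end Resolvent

/-! ### Invertibility -/

theorem isUnit_smul_add_smul_one_sub {A : Type*} [Ring A] [Algebra ℂ A] {p : A} (hp : p * p = p)
    {a b : ℂ} (ha : a ≠ 0) (hb : b ≠ 0) : IsUnit (a • p + b • (1 - p)) := by
  have key : ∀ a b a' b' : ℂ, (a • p + b • (1 - p)) * (a' • p + b' • (1 - p)) =
      (a * a') • p + (b * b') • (1 - p) := by
    intro a b a' b'
    simp only [add_mul, mul_add, smul_mul_smul_comm, hp, mul_sub, sub_mul, mul_one, one_mul,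
      sub_self, smul_zero, add_zero, zero_add, sub_zero]
  refine isUnit_iff_exists.2 ⟨a⁻¹ • p + b⁻¹ • (1 - p), ?_, ?_⟩ <;>
    · rw [key]
      simp [ha, hb]

theorem norm_conj_sub_conj_lt {μ z : ℂ} (hμ : 0 < μ.im) (hz : 0 < z.im) :
    ‖conj z - conj μ‖ < ‖z - conj μ‖ := by
  rw [← sq_lt_sq₀ (norm_nonneg _) (norm_nonneg _), ← Complex.normSq_eq_norm_sq,
    ← Complex.normSq_eq_norm_sq, Complex.normSq_apply, Complex.normSq_apply]
  simp only [Complex.sub_re, Complex.sub_im, Complex.conj_re, Complex.conj_im]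
  nlinarith [mul_pos hμ hz]

theorem isUnit_one_add_smul_resolvent {S : H →ₗ.[ℂ] H} {μ z : ℂ} {R : H →L[ℂ] H}
    (hs : IsSymmetric S) (hμ : 0 < μ.im) (hz : 0 < z.im)
    (hR : ∀ x, (R x, projM S (conj z) x + conj z • R x) ∈ S.graph) :
    IsUnit (1 + (conj z - conj μ) • R) := by
  set P := projM S (conj z)
  have hP : P * P = P := projM_mul_self S _
  have hRP : R * P = R := resolvent_mul_projM hs hz hR
  have hlt := norm_conj_sub_conj_lt hμ hz
  have hw : z - conj z ≠ 0 := by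
    rw [Complex.sub_conj]
    simpa using hz.ne'
  have ha : z - conj μ ≠ 0 := norm_pos_iff.1 ((norm_nonneg _).trans_lt hlt)
  set t : ℂ := (conj z - conj μ) / (z - conj μ) with ht
  have ht1 : ‖t‖ < 1 := by
    rw [ht, norm_div]
    exact (div_lt_one (norm_pos_iff.2 ha)).2 hlt
  -- The contraction `K` vanishes on the range of `1 - P`, so that multiplying `1 - t • K` by an
  -- invertible diagonal operator from the right changes only its part on the range of `P`.
  set K := P - (z - conj z) • R with hK
  have hKP : K * P = K := by
    rw [hK, sub_mul, smul_mul_assoc, hP, hRP]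
  have hfac : 1 + (conj z - conj μ) • R =
      (1 - t • K) * (((z - conj μ) / (z - conj z)) • P + (1 : ℂ) • (1 - P)) := by
    have e1 : (1 - t • K) * (((z - conj μ) / (z - conj z)) • P + (1 : ℂ) • (1 - P)) =
        ((z - conj μ) / (z - conj z)) • P + (1 - P) -
          (t * ((z - conj μ) / (z - conj z))) • K := by
      have hKQ : K * (1 - P) = 0 := by rw [mul_sub, mul_one, hKP, sub_self]
      rw [sub_mul, one_mul, one_smul, smul_mul_assoc, mul_add, hKQ, add_zero, mul_smul_comm, hKP,
        smul_smul]
    have e2 : t * ((z - conj μ) / (z - conj z)) = (conj z - conj μ) / (z - conj z) := by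
      rw [ht]; field_simp
    have e3 : (z - conj μ) / (z - conj z) = 1 + (conj z - conj μ) / (z - conj z) := by
      field_simp; ring
    rw [e1, e2, e3, hK, smul_sub, smul_smul, div_mul_cancel₀ _ hw, add_smul, one_smul]
    abel
  rw [hfac]
  refine IsUnit.mul (isUnit_one_sub_of_norm_lt_one ?_)
    (isUnit_smul_add_smul_one_sub hP (div_ne_zero ha hw) one_ne_zero)
  rw [norm_smul]
  exact (mul_le_of_le_one_right (norm_nonneg _) (norm_cayley_le hs hR)).trans_lt ht1

/-! ### The clone of a symmetric operator -/

theorem ratio_ne_zero {μ z : ℂ} (hμ : 0 < μ.im) (hz : 0 < z.im) : ratio μ z ≠ 0 := by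
  have : 0 < z.im / μ.im := div_pos hz hμ
  simpa [ratio] using (Real.sqrt_pos.2 this).ne'

section Clone

variable {S : H →ₗ.[ℂ] H} {μ z : ℂ}

theorem isUnit_domMap (S : H →ₗ.[ℂ] H) (hμ : 0 < μ.im) (hz : 0 < z.im) :
    IsUnit (domMap S μ z) := by
  have := isUnit_smul_add_smul_one_sub (projM_mul_self S (conj z)) one_ne_zero
    (ratio_ne_zero hμ hz)
  rwa [one_smul, ← projN_eq] at this

theorem domMap_eq_self {x : H} (hx : projM S (conj z) x = x) : domMap S μ z x = x := by
  have hN : projN S z x = 0 := by simp [projN_eq, hx]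
  change projM S (conj z) x + ratio μ z • projN S z x = x
  rw [hx, hN, smul_zero, add_zero]

theorem mem_graph_clone_iff (hμ : 0 < μ.im) (hz : 0 < z.im) {p : H × H} :
    p ∈ (clone S μ z).graph ↔
      ∃ q ∈ S.graph, (domMap S μ z q.1, valMap S μ z q.2) = p := by
  rw [clone, Submodule.toLinearPMap_graph_eq]
  · rfl
  · rintro _ ⟨⟨a, b⟩, hab, rfl⟩ h0
    have ha : a = 0 := domMap_injective S hμ hz (by simpa using h0)
    have hb : b = 0 := S.graph_fst_eq_zero_snd hab ha
    simp [hb]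

/-- On `dom S`, the deficiency component of `S` is multiplication by `conj z`. -/
theorem projN_of_mem_graph {x y : H} (h : (x, y) ∈ S.graph) :
    projN S z y = conj z • projN S z x := by
  have h1 : projN S z (y - conj z • x) = 0 := by
    rw [projN_eq]
    exact sub_eq_zero.2 (projM_sub_smul h).symm
  rw [map_sub, map_smul] at h1
  exact sub_eq_zero.1 h1

theorem valMap_of_mem_graph (hz : 0 < z.im) {x y : H} (h : (x, y) ∈ S.graph) :
    valMap S μ z y = projM S (conj z) y + (conj μ * ratio μ z) • projN S z x := by
  have hz0 : conj z ≠ 0 := by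
    intro h0
    have := congrArg Complex.im h0
    simp at this
    exact hz.ne' this
  change projM S (conj z) y + ((conj μ / conj z) * ratio μ z) • projN S z y = _
  rw [projN_of_mem_graph h, smul_smul]
  congr 2
  field_simp

/-- The resolvents of `S` at `conj z` and of its clone at `conj μ` agree up to a bounded invertible
operator. With `R` the resolvent of `S` and `c = conj z - conj μ`, this operator is
`domMap * (1 + c R)⁻¹`. -/
theorem exists_resolventSimilar_clone (hc : S.IsClosed) (hs : IsSymmetric S)
    (hμ : 0 < μ.im) (hz : 0 < z.im) :
    ∃ G : H ≃L[ℂ] H, ResolventSimilar S (clone S μ z) (conj z) (conj μ) G := by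
  obtain ⟨R, hR⟩ := exists_resolvent hc hs hz
  obtain ⟨T, hT⟩ := isUnit_one_add_smul_resolvent hs hμ hz hR
  obtain ⟨D, hD⟩ := isUnit_domMap S hμ hz
  have hRP := resolvent_mul_projM hs hz hR
  have hPP := projM_mul_self S (conj z)
  set P := projM S (conj z) with hPdef
  set c := conj z - conj μ with hcdef
  have hTx : ∀ x, (T : H →L[ℂ] H) x = x + c • R x := fun x => by rw [hT]; rfl
  have hTR : ∀ x, (T : H →L[ℂ] H) (R x) = R ((T : H →L[ℂ] H) x) := fun x => by
    rw [hTx, hTx, map_add, map_smul]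
  have hRPx : ∀ x, R (P x) = R x := fun x => DFunLike.congr_fun hRP x
  have hPPx : ∀ x, P (P x) = P x := fun x => DFunLike.congr_fun hPP x
  have hPTP : ∀ x, P ((T : H →L[ℂ] H) (P x)) = P ((T : H →L[ℂ] H) x) := fun x => by
    rw [hTx, hTx, hRPx, map_add, map_add, hPPx]
  have hTT : ∀ x, (T : H →L[ℂ] H) ((↑T⁻¹ : H →L[ℂ] H) x) = x := fun x =>
    DFunLike.congr_fun T.mul_inv x
  let G : H ≃L[ℂ] H := ContinuousLinearEquiv.unitsEquiv ℂ H (D * T⁻¹)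
  have hG : ∀ x, G ((T : H →L[ℂ] H) x) = domMap S μ z x := fun x => by
    rw [← hD]
    exact congrArg (D : H →L[ℂ] H) (DFunLike.congr_fun T.inv_mul x)
  -- The clone, described through the resolvent of `S`.
  have hclone : ∀ u m, (u, m + conj μ • u) ∈ (clone S μ z).graph ↔
      ∃ m₀, P m₀ = m₀ ∧ domMap S μ z (R m₀) = u ∧ P ((T : H →L[ℂ] H) m₀) = m := by
    have hval : ∀ m₀, P m₀ = m₀ → valMap S μ z (m₀ + conj z • R m₀) =
        P ((T : H →L[ℂ] H) m₀) + conj μ • domMap S μ z (R m₀) := fun m₀ hm₀ => by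
      have hg : (R m₀, m₀ + conj z • R m₀) ∈ S.graph :=
        (mem_graph_iff_resolvent hs hz hR).2 ⟨hm₀, rfl⟩
      have hd : domMap S μ z (R m₀) = P (R m₀) + ratio μ z • projN S z (R m₀) := rfl
      rw [valMap_of_mem_graph hz hg, hd, hTx, map_add, map_add, map_smul, map_smul, ← hPdef,
        hcdef, sub_smul, smul_add, smul_smul]
      abel
    intro u m
    rw [mem_graph_clone_iff hμ hz]
    constructor
    · rintro ⟨⟨x, y⟩, hxy, he⟩
      obtain ⟨he1, he2⟩ := Prod.ext_iff.1 he
      have hxy' : (x, (y - conj z • x) + conj z • x) ∈ S.graph := by rwa [sub_add_cancel]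
      obtain ⟨hm, hx⟩ := (mem_graph_iff_resolvent hs hz hR).1 hxy'
      refine ⟨y - conj z • x, hm, by rw [hx]; exact he1, ?_⟩
      have h1 := hval _ hm
      rw [hx, sub_add_cancel] at h1
      have h2 : valMap S μ z y = m + conj μ • u := he2
      have h3 : domMap S μ z x = u := he1
      rw [h2, h3] at h1
      exact (add_right_cancel h1).symm
    · rintro ⟨m₀, hm₀, rfl, rfl⟩
      exact ⟨(R m₀, m₀ + conj z • R m₀), (mem_graph_iff_resolvent hs hz hR).2 ⟨hm₀, rfl⟩,
        Prod.ext rfl (hval m₀ hm₀)⟩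
  refine ⟨G, ⟨fun x m => ?_, fun x m hxm => ?_⟩⟩
  · rw [mem_graph_iff_resolvent hs hz hR, hclone]
    constructor
    · rintro ⟨hm, rfl⟩
      -- `T` is block triangular (`P T P = P T`), so that `P T⁻¹` inverts `P T` on the range of `P`.
      refine ⟨P ((↑T⁻¹ : H →L[ℂ] H) m), hPPx _, ?_, ?_⟩
      · rw [← hG, hTR, ← hRPx, hPTP, hTT, hRPx]
      · rw [hPTP, hTT, hm]
    · rintro ⟨m₀, -, h1, rfl⟩
      refine ⟨hPPx _, ?_⟩
      rw [← hG] at h1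
      rw [hRPx, ← hTR, G.injective h1]
  · have hm := ((mem_graph_iff_resolvent hs hz hR).1 hxm).1
    have hDm : domMap S μ z m = m := domMap_eq_self hm
    rw [clone_domain]
    constructor
    · intro h
      exact ⟨m, h, hDm⟩
    · rintro ⟨f, hf, hfm⟩
      have hfm' : domMap S μ z f = domMap S μ z m := hfm.trans hDm.symm
      rwa [← domMap_injective S hμ hz hfm']

theorem inner_projM_projN (S : H →ₗ.[ℂ] H) (z : ℂ) (x y : H) :
    inner ℂ (projM S (conj z) x) (projN S z y) = 0 := by
  have hN : projN S z y ∈ (rangeSub S (conj z)).topologicalClosureᗮ := by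
    rw [Submodule.orthogonal_closure]
    exact Submodule.starProjection_apply_mem _ y
  exact hN _ (Submodule.starProjection_apply_mem _ x)

theorem inner_projM_add_projN (S : H →ₗ.[ℂ] H) (z a b : ℂ) (x y x' y' : H) :
    inner ℂ (projM S (conj z) x + a • projN S z x') (projM S (conj z) y + b • projN S z y') =
      inner ℂ (projM S (conj z) x) (projM S (conj z) y) +
        conj a * b * inner ℂ (projN S z x') (projN S z y') := by
  have h' : inner ℂ (projN S z x') (projM S (conj z) y) = 0 := by
    rw [← inner_conj_symm, inner_projM_projN, map_zero]
  simp only [inner_add_left, inner_add_right, inner_smul_left, inner_smul_right,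
    inner_projM_projN, h', mul_zero, add_zero, zero_add]
  ring

/-- The clone is symmetric: replacing `z` by `μ` in the deficiency component changes the imaginary
part of the quadratic form by the factor `Im μ / Im z`, and the square of `ratio μ z` makes up for
this. -/
theorem isSymmetric_clone (hs : IsSymmetric S) (hμ : 0 < μ.im) (hz : 0 < z.im) :
    IsSymmetric (clone S μ z) := by
  intro f
  obtain ⟨⟨x, y⟩, hxy, he⟩ := (mem_graph_clone_iff hμ hz).1 ((clone S μ z).mem_graph f)
  obtain ⟨he1, he2⟩ := Prod.ext_iff.1 he
  have he1' : domMap S μ z x = f := he1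
  have he2' : valMap S μ z y = clone S μ z f := he2
  have hd : domMap S μ z x = projM S (conj z) x + ratio μ z • projN S z x := rfl
  have hN : inner ℂ (projN S z x) (projN S z x) = ((‖projN S z x‖ ^ 2 : ℝ) : ℂ) := by
    rw [inner_self_eq_norm_sq_to_K]
    simp
  have horig := inner_im_eq_zero_of_mem_graph hs hxy
  have hsplit := inner_projM_add_projN S z 1 1 y x y x
  simp only [one_smul, projM_add_projN, map_one, one_mul] at hsplit
  rw [hsplit, projN_of_mem_graph hxy, inner_smul_left, Complex.conj_conj, hN, Complex.add_im,
    Complex.im_mul_ofReal] at horig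
  have hk : ratio μ z * ratio μ z = ((z.im / μ.im : ℝ) : ℂ) := by
    rw [ratio, ← Complex.ofReal_mul, Real.mul_self_sqrt (div_pos hz hμ).le]
  have hcoef : conj (conj μ * ratio μ z) * ratio μ z = μ * ((z.im / μ.im : ℝ) : ℂ) := by
    rw [map_mul, Complex.conj_conj, mul_assoc, ← hk]
    congr 2
    exact Complex.conj_ofReal _
  rw [← he1', ← he2', valMap_of_mem_graph hz hxy, hd, inner_projM_add_projN, hN, hcoef,
    Complex.add_im, Complex.im_mul_ofReal, Complex.im_mul_ofReal, mul_div_cancel₀ _ hμ.ne']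
  exact horig

end Clone

theorem tfae_exists_forall {p : ℂ → ℂ → Prop} {q : Prop}
    (h : ∀ μ z : ℂ, 0 < μ.im → 0 < z.im → (p μ z ↔ q)) :
    List.TFAE [∃ μ z : ℂ, 0 < μ.im ∧ 0 < z.im ∧ p μ z,
      ∀ μ z : ℂ, 0 < μ.im → 0 < z.im → p μ z, q] := by
  have hI : 0 < Complex.I.im := by simp
  tfae_have 1 → 3 := fun ⟨μ, z, hμ, hz, hp⟩ => (h μ z hμ hz).1 hp
  tfae_have 3 → 2 := fun hq μ z hμ hz => (h μ z hμ hz).2 hq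
  tfae_have 2 → 1 := fun hp => ⟨_, _, hI, hI, hp _ _ hI hI⟩
  tfae_finish

end SymmetricClone

theorem theorem9p2 {H : Type*} [NormedAddCommGroup H] [InnerProductSpace ℂ H] [CompleteSpace H]
    (S : H →ₗ.[ℂ] H) (hd : Dense (S.domain : Set H)) (hc : S.IsClosed)
    (hs : SymmetricClone.IsSymmetric S)
    (hn : SymmetricClone.posDeficiencyIndex S ≠ 0) :
    (∀ μ z : ℂ, 0 < μ.im → 0 < z.im →
      SymmetricClone.IsSymmetric (SymmetricClone.clone S μ z) ∧
      Dense ((SymmetricClone.clone S μ z).domain : Set H) ∧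
      (SymmetricClone.clone S μ z).IsClosed) ∧
    List.TFAE [
      ∃ μ z : ℂ, 0 < μ.im ∧ 0 < z.im ∧
        (SymmetricClone.clone S μ z).HasCore
          (SymmetricClone.square (SymmetricClone.clone S μ z)).domain,
      ∀ μ z : ℂ, 0 < μ.im → 0 < z.im →
        (SymmetricClone.clone S μ z).HasCore
          (SymmetricClone.square (SymmetricClone.clone S μ z)).domain,
      S.HasCore (SymmetricClone.square S).domain] ∧
    List.TFAE [
      ∃ μ z : ℂ, 0 < μ.im ∧ 0 < z.im ∧
        (Dense ((SymmetricClone.square (SymmetricClone.clone S μ z)).domain : Set H) ∧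
        ¬ (SymmetricClone.clone S μ z).HasCore
          (SymmetricClone.square (SymmetricClone.clone S μ z)).domain),
      ∀ μ z : ℂ, 0 < μ.im → 0 < z.im →
        (Dense ((SymmetricClone.square (SymmetricClone.clone S μ z)).domain : Set H) ∧
        ¬ (SymmetricClone.clone S μ z).HasCore
          (SymmetricClone.square (SymmetricClone.clone S μ z)).domain),
      Dense ((SymmetricClone.square S).domain : Set H) ∧
        ¬ S.HasCore (SymmetricClone.square S).domain] ∧
    List.TFAE [
      ∃ μ z : ℂ, 0 < μ.im ∧ 0 < z.im ∧
        ¬ Dense ((SymmetricClone.square (SymmetricClone.clone S μ z)).domain : Set H),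
      ∀ μ z : ℂ, 0 < μ.im → 0 < z.im →
        ¬ Dense ((SymmetricClone.square (SymmetricClone.clone S μ z)).domain : Set H),
      ¬ Dense ((SymmetricClone.square S).domain : Set H)] ∧
    List.TFAE [
      ∃ μ z : ℂ, 0 < μ.im ∧ 0 < z.im ∧
        (SymmetricClone.square (SymmetricClone.clone S μ z)).domain = ⊥,
      ∀ μ z : ℂ, 0 < μ.im → 0 < z.im →
        (SymmetricClone.square (SymmetricClone.clone S μ z)).domain = ⊥,
      (SymmetricClone.square S).domain = ⊥] := by
  have hsim : ∀ μ z : ℂ, 0 < μ.im → 0 < z.im → ∃ G : H ≃L[ℂ] H, SymmetricClone.ResolventSimilar S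
      (SymmetricClone.clone S μ z) (conj z) (conj μ) G := fun μ z hμ hz =>
    SymmetricClone.exists_resolventSimilar_clone hc hs hμ hz
  choose! G hG using hsim
  have hcore := fun μ z hμ hz => (hG μ z hμ hz).hasCore_iff hc
  have hdense := fun μ z hμ hz => (hG μ z hμ hz).dense_square_domain_iff
  refine ⟨fun μ z hμ hz => ⟨SymmetricClone.isSymmetric_clone hs hμ hz,
      (hG μ z hμ hz).dense_domain hd, (hG μ z hμ hz).isClosed hc⟩,
    SymmetricClone.tfae_exists_forall hcore,
    SymmetricClone.tfae_exists_forall fun μ z hμ hz =>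
      and_congr (hdense μ z hμ hz) (not_congr (hcore μ z hμ hz)),
    SymmetricClone.tfae_exists_forall fun μ z hμ hz => not_congr (hdense μ z hμ hz),
    SymmetricClone.tfae_exists_forall fun μ z hμ hz =>
      (hG μ z hμ hz).square_domain_eq_bot_iff⟩
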